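/- Every space is Tychonoff (completely regular and $T_0$), and $C_p(X)$ denotes the space of all continuous functions $X\to\mathbb{R}$ with the topology of pointwise convergence. A Tychonoff space $X$ is a *$\kappa$-space* if it is homeomorphic to a closed subspace of $C_p(Y)$ for some locally compact Hausdorff space $Y$. It is a *$\mu$-space* if every subset $A\subseteq X$ on which each continuous function $X\to\mathbb{R}$ is bounded has compact closure. It is a *$k_{\mathbb{R}}$-space* if every function $X\to\mathbb{R}$ whose restriction to each compact subset of $X$ is continuous is continuous. It is *realcompact* if it is not a proper dense subspace of a Tychonoff space to which every continuous real-valued function on $X$ extends continuously. It is *Dieudonné complete* if its topology is induced by a complete uniformity, and *pseudocompact* if every continuous function $X\to\mathbb{R}$ is bounded. A *perfect mapping* is a continuous closed map with compact fibres. **Proposition.** 1. An arbitrary product of $\kappa$-spaces is a $\kappa$-space. 2. A closed subspace of a $\kappa$-space is a $\kappa$-space. 3. Each realcompact space is a $\kappa$-space. 4. If $\mathcal{M}$ is a nonempty family of subspaces of a Tychonoff space $X$, each of which is a $\kappa$-space, then $\bigcap\mathcal{M}$ is a $\kappa$-space. 5. If $X$ is a Tychonoff space, $f:X\to Y$ is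 a perfect mapping and $Y$ is a $\kappa$-space, then $X$ is a $\kappa$-space. 6. If $X$ is a Tychonoff space and $C_p(X)$ is a $k_{\mathbb{R}}$-space, then $X$ is a $\kappa$-space. 7. Each $\kappa$-space is a $\mu$-space. 8. Each metrizable space is a $\kappa$-space. 9. Each Dieudonné complete space is a $\kappa$-space. 10. A pseudocompact space is a $\kappa$-space if and only if it is compact. Consequently, the space $\omega_1$ of all countable ordinals with the order topology, which is first countable and pseudocompact, is not a $\kappa$-space. 11. If $X$ is a $k_{\mathbb{R}}$-space, then $C_p(X)$ is a $\kappa$-space. -/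

import Mathlib

universe u v

/-- `C_p(X)`: the continuous real-valued functions on `X`, with the topology of pointwise
convergence, i.e. the subspace topology inherited from the product `X → ℝ`. -/
abbrev Cp (X : Type u) [TopologicalSpace X] : Type u := {f : X → ℝ // Continuous f}

/-- A `κ`-space: a Tychonoff space that is homeomorphic to a closed subspace of `C_p(Y)` for some
locally compact (Hausdorff, hence Tychonoff) space `Y`. -/
structure IsKappaSpace (X : Type u) [TopologicalSpace X] : Prop where
  t35 : T35Space X
  exists_closed_embedding : ∃ (Y : Type u) (_ : TopologicalSpace Y),
    T2Space Y ∧ LocallyCompactSpace Y ∧ ∃ e : X → Cp Y, Topology.IsClosedEmbedding e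

/-- `A` is functionally bounded in `X`: each continuous real-valued function on `X` is bounded
on `A`. -/
def IsFunctionallyBounded {X : Type u} [TopologicalSpace X] (A : Set X) : Prop :=
  ∀ f : X → ℝ, Continuous f → Bornology.IsBounded (f '' A)

/-- A `μ`-space: a Tychonoff space whose functionally bounded subsets have compact closure. -/
structure IsMuSpace (X : Type u) [TopologicalSpace X] : Prop where
  t35 : T35Space X
  isCompact_closure : ∀ A : Set X, IsFunctionallyBounded A → IsCompact (closure A)

/-- A `k_ℝ`-space: a Tychonoff space on which each real-valued function whose restrictions to all
compact subsets are continuous is itself continuous. -/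
structure IsKRSpace (X : Type u) [TopologicalSpace X] : Prop where
  t35 : T35Space X
  continuous_of_continuousOn : ∀ f : X → ℝ,
    (∀ K : Set X, IsCompact K → ContinuousOn f K) → Continuous f

/-- A realcompact space: a Tychonoff space that is not a proper dense subspace of a Tychonoff
space to which all its continuous real-valued functions extend continuously. -/
structure IsRealcompactSpace (X : Type u) [TopologicalSpace X] : Prop where
  t35 : T35Space X
  surjective_of_extends : ∀ (Z : Type u) [TopologicalSpace Z] [T35Space Z] (e : X → Z),
    Topology.IsEmbedding e → DenseRange e →
    (∀ f : X → ℝ, Continuous f → ∃ g : Z → ℝ, Continuous g ∧ ∀ x, g (e x) = f x) →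
    Function.Surjective e

/-- A Dieudonné complete space: a Tychonoff space whose topology is induced by a complete
uniformity. -/
structure IsDieudonneComplete (X : Type u) [t : TopologicalSpace X] : Prop where
  t35 : T35Space X
  exists_complete_uniformity : ∃ U : UniformSpace X,
    U.toTopologicalSpace = t ∧ @CompleteSpace X U

/-- A pseudocompact space: a Tychonoff space on which each continuous real-valued function is
bounded. -/
structure IsPseudocompactSpace (X : Type u) [TopologicalSpace X] : Prop where
  t35 : T35Space X
  isBounded_range : ∀ f : X → ℝ, Continuous f → Bornology.IsBounded (Set.range f)

/-! Being a `κ`-space is a completeness property: `X` is a `κ`-space iff every `IsKappaCauchy`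
ultrafilter converges. One direction embeds `X` by evaluation into `Cp` of the disjoint sum of all
compact subsets of `Cp X`; limits of the image are exactly limit functionals continuous on compacta
(`of_forall_ultrafilter`). The other transposes a closed embedding
(`exists_le_nhds_of_isClosedEmbedding`). Since continuous maps preserve such ultrafilters, the
permanence properties follow by chasing limits. The analytic inputs are: an ultrafilter containing a
functionally bounded set is `IsKappaCauchy`, which gives compact closures; and on a pseudometric
space `IsKappaCauchy` implies Cauchy, which gives the metrizable and Dieudonné complete cases. -/

section KappaSpaces

open Filter Topology Uniformity

namespace Cp

variable {X : Type u} {Y : Type v} [TopologicalSpace X] [TopologicalSpace Y]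

theorem continuous_eval (x : X) : Continuous fun f : Cp X => f.1 x :=
  (continuous_apply x).comp continuous_subtype_val

theorem continuous_iff {f : Y → Cp X} : Continuous f ↔ ∀ x, Continuous fun y => (f y).1 x := by
  rw [continuous_induced_rng, continuous_pi_iff]
  rfl

theorem tendsto_iff {α : Type*} {l : Filter α} {f : α → Cp X} {g : Cp X} :
    Tendsto f l (𝓝 g) ↔ ∀ x, Tendsto (fun a => (f a).1 x) l (𝓝 (g.1 x)) := by
  rw [tendsto_subtype_rng, tendsto_pi_nhds]

/-- Composition with a continuous map, as a map between function spaces. -/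
def comp (φ : X → Y) (hφ : Continuous φ) (f : Cp Y) : Cp X := ⟨f.1 ∘ φ, f.2.comp hφ⟩

theorem continuous_comp (φ : X → Y) (hφ : Continuous φ) : Continuous (comp φ hφ) :=
  continuous_iff.2 fun x => continuous_eval (φ x)

end Cp

theorem T35Space.of_isEmbedding {X : Type u} {Y : Type v} [TopologicalSpace X] [TopologicalSpace Y]
    [T35Space Y] {f : X → Y} (hf : IsEmbedding f) : T35Space X :=
  have := hf.isInducing.completelyRegularSpace
  have := hf.t2Space
  {}

instance T35Space.subtype {X : Type u} [TopologicalSpace X] [T35Space X] (p : X → Prop) :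
    T35Space (Subtype p) := .of_isEmbedding .subtypeVal

instance T35Space.pi {ι : Type v} {X : ι → Type u} [∀ i, TopologicalSpace (X i)]
    [∀ i, T35Space (X i)] : T35Space (∀ i, X i) where

theorem T35Space.exists_continuous_real {X : Type u} [TopologicalSpace X] [T35Space X] {x : X}
    {U : Set X} (hU : U ∈ 𝓝 x) : ∃ f : Cp X, f.1 x = 0 ∧ ∀ y ∉ U, f.1 y = 1 := by
  obtain ⟨V, hVU, hV, hx⟩ := mem_nhds_iff.1 hU
  obtain ⟨f, hf, h0, h1⟩ := CompletelyRegularSpace.completely_regular_isOpen x V hV hx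
  refine ⟨⟨fun y => f y, continuous_subtype_val.comp hf⟩, by simp [h0], fun y hy => ?_⟩
  have := h1 (fun h => hy (hVU h) : y ∈ Vᶜ)
  simp [this]

/-- A filter along which each continuous real function converges to its value at `x` converges
to `x`. -/
theorem T35Space.le_nhds_of_forall_tendsto {X : Type u} [TopologicalSpace X] [T35Space X] {x : X}
    {F : Filter X} (h : ∀ f : Cp X, Tendsto f.1 F (𝓝 (f.1 x))) : F ≤ 𝓝 x := by
  intro U hU
  obtain ⟨f, h0, h1⟩ := exists_continuous_real hU
  have := h f
  rw [h0] at this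
  filter_upwards [this.eventually_lt_const zero_lt_one] with y hy
  by_contra hyU
  exact hy.ne (h1 y hyU)

/-! ### Limit functionals of ultrafilters -/

namespace Ultrafilter

variable {X : Type u} {Y : Type v} [TopologicalSpace X] [TopologicalSpace Y]

/-- `L` is the functional assigning to each continuous function its limit along `F`. -/
def HasLimits (F : Ultrafilter X) (L : Cp X → ℝ) : Prop :=
  ∀ f : Cp X, Tendsto f.1 F (𝓝 (L f))

/-- All continuous real functions converge along `F`, and their limit is continuous on each
compact subset of `C_p(X)`. -/
def IsKappaCauchy (F : Ultrafilter X) : Prop :=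
  ∃ L : Cp X → ℝ, F.HasLimits L ∧ ∀ K : Set (Cp X), IsCompact K → ContinuousOn L K

theorem HasLimits.map {F : Ultrafilter X} {L : Cp X → ℝ} (h : F.HasLimits L) {φ : X → Y}
    (hφ : Continuous φ) : (F.map φ).HasLimits (L ∘ Cp.comp φ hφ) := fun f =>
  tendsto_map'_iff.2 (h (Cp.comp φ hφ f))

theorem IsKappaCauchy.map {F : Ultrafilter X} (h : F.IsKappaCauchy) {φ : X → Y}
    (hφ : Continuous φ) : (F.map φ).IsKappaCauchy := by
  obtain ⟨L, hL, hK⟩ := h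
  exact ⟨_, hL.map hφ, fun K hKc => (hK _ (hKc.image (Cp.continuous_comp φ hφ))).comp
    (Cp.continuous_comp φ hφ).continuousOn (Set.mapsTo_image _ _)⟩

/-- If `m` were missed, `1 / dist (φ x) m` would be continuous with a finite limit along `F`,
although its product with a null function is 1. -/
theorem HasLimits.mem_range_of_tendsto {M : Type v} [TopologicalSpace M]
    [TopologicalSpace.MetrizableSpace M] {F : Ultrafilter X} {L : Cp X → ℝ} (h : F.HasLimits L)
    {φ : X → M} (hφ : Continuous φ) {m : M} (hm : Tendsto φ F (𝓝 m)) : m ∈ Set.range φ := by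
  let _ := TopologicalSpace.metrizableSpaceMetric M
  by_contra hr
  have hne : ∀ x, dist (φ x) m ≠ 0 := fun x h0 => hr ⟨x, dist_eq_zero.1 h0⟩
  have hd : Continuous fun x => dist (φ x) m := hφ.dist continuous_const
  have h1 := h ⟨fun x => (dist (φ x) m)⁻¹, hd.inv₀ hne⟩
  have h2 := h1.mul (tendsto_iff_dist_tendsto_zero.1 hm)
  simp only [inv_mul_cancel₀ (hne _), mul_zero] at h2
  exact one_ne_zero (tendsto_nhds_unique tendsto_const_nhds h2)

theorem HasLimits.exists_eval_eq {F : Ultrafilter X} {L : Cp X → ℝ} (h : F.HasLimits L)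
    (d : ℕ → Cp X) : ∃ x, ∀ n, (d n).1 x = L (d n) := by
  obtain ⟨x, hx⟩ := h.mem_range_of_tendsto (φ := fun x n => (d n).1 x) (m := fun n => L (d n))
    (continuous_pi fun n => (d n).2) (tendsto_pi_nhds.2 fun n => h (d n))
  exact ⟨x, fun n => congrFun hx n⟩

/-- Choose a second point `y` representing `L` on `q` as well. Evaluations at `x` and `y` agree on
all `d n`, hence on their closure. -/
theorem HasLimits.eval_eq_of_mem_closure {F : Ultrafilter X} {L : Cp X → ℝ} (h : F.HasLimits L)
    {d : ℕ → Cp X} {x : X} (hx : ∀ n, (d n).1 x = L (d n)) {q : Cp X}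
    (hq : q ∈ closure (Set.range d)) : q.1 x = L q := by
  obtain ⟨y, hy⟩ := h.exists_eval_eq fun n => Nat.casesOn n q d
  have hyq : q.1 y = L q := hy 0
  rw [← hyq]
  have hc : IsClosed {f : Cp X | f.1 x = f.1 y} :=
    isClosed_eq (Cp.continuous_eval x) (Cp.continuous_eval y)
  refine closure_minimal ?_ hc hq
  rintro _ ⟨n, rfl⟩
  exact (hx n).trans (hy (n + 1)).symm

/-- A limit functional which is continuous on all of `C_p(X)` is an evaluation. -/
theorem HasLimits.exists_le_nhds_of_continuous [T35Space X] {F : Ultrafilter X} {L : Cp X → ℝ}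
    (h : F.HasLimits L) (hL : Continuous L) : ∃ x, (F : Filter X) ≤ 𝓝 x := by
  by_contra! hF
  have key : ∀ x, ∃ f : Cp X, f.1 x = 0 ∧ ∀ᶠ y in F, f.1 y = 1 := fun x => by
    obtain ⟨U, hU, hUF⟩ := Filter.not_le.1 (hF x)
    obtain ⟨f, h0, h1⟩ := T35Space.exists_continuous_real hU
    exact ⟨f, h0, mem_of_superset (Ultrafilter.compl_mem_iff_notMem.2 hUF) h1⟩
  choose f h0 h1 using key
  let z : Cp X := ⟨fun _ => 0, continuous_const⟩
  -- Each point eventually kills these products, so they tend to 0 pointwise; each is 1 on a set of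
  -- `F`.
  let p (s : Finset X) : Cp X :=
    ⟨fun y => ∏ x ∈ s, (f x).1 y, continuous_finsetProd _ fun x _ => (f x).2⟩
  have hp : Tendsto p atTop (𝓝 z) := by
    refine Cp.tendsto_iff.2 fun x => tendsto_const_nhds.congr' ?_
    filter_upwards [eventually_ge_atTop {x}] with s hs
    exact (Finset.prod_eq_zero (f := fun j => (f j).1 x) (Finset.singleton_subset_iff.1 hs) (h0 x)).symm
  have hLp : ∀ s, L (p s) = 1 := fun s => by
    refine tendsto_nhds_unique (h (p s)) (tendsto_const_nhds.congr' ?_)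
    have : ∀ᶠ y in F, ∀ x ∈ s, (f x).1 y = 1 := (s.eventually_all).2 fun x _ => h1 x
    filter_upwards [this] with y hy
    exact (Finset.prod_eq_one hy).symm
  have hz : L z = 0 := tendsto_nhds_unique (h z) tendsto_const_nhds
  have := (hL.tendsto z).comp hp
  simp only [Function.comp_def, hLp, hz] at this
  exact one_ne_zero (tendsto_nhds_unique tendsto_const_nhds this)

end Ultrafilter

/-! ### Ultrafilter characterization of `κ`-spaces -/

theorem LocallyCompactSpace.sigma {ι : Type u} {Z : ι → Type v} [∀ i, TopologicalSpace (Z i)]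
    [∀ i, LocallyCompactSpace (Z i)] : LocallyCompactSpace (Σ i, Z i) := by
  refine ⟨fun ⟨i, z⟩ n hn => ?_⟩
  rw [Sigma.nhds_mk] at hn
  obtain ⟨s, hs, hsn, hsc⟩ := LocallyCompactSpace.local_compact_nhds z _ (mem_map.1 hn)
  exact ⟨Sigma.mk i '' s, Sigma.nhds_mk i z ▸ image_mem_map hs, Set.image_subset_iff.2 hsn,
    hsc.image continuous_sigmaMk⟩

/-- The property shared by `k_ℝ`-spaces and locally compact spaces. -/
theorem LocallyCompactSpace.continuous_of_continuousOn {Y : Type v} [TopologicalSpace Y]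
    [LocallyCompactSpace Y] {f : Y → ℝ} (h : ∀ K, IsCompact K → ContinuousOn f K) :
    Continuous f := by
  refine continuous_iff_continuousAt.2 fun y => ?_
  obtain ⟨K, hK, hy⟩ := exists_compact_mem_nhds y
  exact (h K hK).continuousAt hy

theorem Ultrafilter.IsKappaCauchy.exists_le_nhds_of_isClosedEmbedding {X : Type u} {Z : Type v}
    [TopologicalSpace X] [TopologicalSpace Z]
    (hZ : ∀ f : Z → ℝ, (∀ K, IsCompact K → ContinuousOn f K) → Continuous f)
    {e : X → Cp Z} (he : IsClosedEmbedding e) {F : Ultrafilter X} (hF : F.IsKappaCauchy) :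
    ∃ x, (F : Filter X) ≤ 𝓝 x := by
  obtain ⟨L, hL, hK⟩ := hF
  let ψ (z : Z) : Cp X := ⟨fun x => (e x).1 z, (Cp.continuous_eval z).comp he.continuous⟩
  have hψ : Continuous ψ := Cp.continuous_iff.2 fun x => (e x).2
  let h : Cp Z := ⟨L ∘ ψ, hZ _ fun K hKc =>
    (hK _ (hKc.image hψ)).comp hψ.continuousOn (Set.mapsTo_image _ _)⟩
  have ht : Tendsto e F (𝓝 h) := Cp.tendsto_iff.2 fun z => hL (ψ z)
  obtain ⟨x, hx⟩ := he.isClosed_range.mem_of_tendsto ht (Eventually.of_forall Set.mem_range_self)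
  refine ⟨x, ?_⟩
  rw [he.isInducing.nhds_eq_comap, hx]
  exact tendsto_iff_comap.1 ht

theorem IsKappaSpace.of_forall_ultrafilter {X : Type u} [TopologicalSpace X] [T35Space X]
    (h : ∀ F : Ultrafilter X, F.IsKappaCauchy → ∃ x, (F : Filter X) ≤ 𝓝 x) : IsKappaSpace X := by
  refine ⟨‹_›, Σ K : {K : Set (Cp X) // IsCompact K}, K.1, inferInstance, inferInstance, ?_, ?_⟩
  · have (K : {K : Set (Cp X) // IsCompact K}) : CompactSpace K.1 := isCompact_iff_compactSpace.1 K.2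
    exact .sigma
  let e (x : X) : Cp (Σ K : {K : Set (Cp X) // IsCompact K}, K.1) :=
    ⟨fun k => k.2.1.1 x, continuous_sigma fun K =>
      (Cp.continuous_eval x).comp continuous_subtype_val⟩
  have he : Continuous e := Cp.continuous_iff.2 fun k => k.2.1.2
  have hinj : Function.Injective e := fun x y hxy => by
    by_contra hne
    obtain ⟨f, h0, h1⟩ := T35Space.exists_continuous_real (isOpen_ne.mem_nhds hne : {y}ᶜ ∈ 𝓝 x)
    have := congrFun (congrArg Subtype.val hxy) ⟨⟨{f}, isCompact_singleton⟩, ⟨f, rfl⟩⟩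
    simp only [e, h0, h1 y (by simp)] at this
    exact zero_ne_one this
  refine ⟨e, .of_continuous_injective_isClosedMap he hinj (IsProperMap.isClosedMap ?_)⟩
  refine isProperMap_iff_ultrafilter_of_t2.2 ⟨he, fun F g hg => h F ?_⟩
  rw [Cp.tendsto_iff] at hg
  refine ⟨fun f => g.1 ⟨⟨{f}, isCompact_singleton⟩, ⟨f, rfl⟩⟩, fun f => hg _, fun K hK => ?_⟩
  rw [continuousOn_iff_continuous_domRestrict]
  refine (g.2.comp (continuous_sigmaMk (i := ⟨K, hK⟩))).congr fun f => ?_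
  -- Copies of `f` in different summands have the same limit, so `g` on the summand `K` is `L`
  -- restricted to `K`.
  exact tendsto_nhds_unique (hg _) (hg ⟨⟨{f.1}, isCompact_singleton⟩, ⟨f.1, rfl⟩⟩)

theorem IsKappaSpace.exists_le_nhds {X : Type u} [TopologicalSpace X] (hX : IsKappaSpace X)
    {F : Ultrafilter X} (hF : F.IsKappaCauchy) : ∃ x, (F : Filter X) ≤ 𝓝 x := by
  obtain ⟨Y, _, _, _, e, he⟩ := hX.exists_closed_embedding
  exact hF.exists_le_nhds_of_isClosedEmbedding
    (fun _ => LocallyCompactSpace.continuous_of_continuousOn) he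

/-! ### Functionally bounded sets and `μ`-spaces -/

/-- Asanov–Velichko: limits along a functionally bounded set are continuous on compact subsets of
the function space. -/
theorem IsFunctionallyBounded.isKappaCauchy {X : Type u} [TopologicalSpace X] {A : Set X}
    (hA : IsFunctionallyBounded A) {F : Ultrafilter X} (hAF : A ∈ F) : F.IsKappaCauchy := by
  have lim : ∀ G : Ultrafilter X, A ∈ G → ∃ L, G.HasLimits L := fun G hG => by
    have (f : Cp X) : ∃ a, Tendsto f.1 G (𝓝 a) := by
      have hc : IsCompact (closure (f.1 '' A)) := (hA f.1 f.2).isCompact_closure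
      obtain ⟨a, -, ha⟩ := isCompact_iff_ultrafilter_le_nhds.1 hc (G.map f.1)
        (le_principal_iff.2 (mem_of_superset (image_mem_map hG) subset_closure))
      exact ⟨a, ha⟩
    choose L hL using this
    exact ⟨L, hL⟩
  obtain ⟨L, hL⟩ := lim F hAF
  refine ⟨L, hL, fun K hK p hp => ?_⟩
  by_contra hcont
  obtain ⟨ε, hε, hfreq⟩ : ∃ ε > 0, ∃ᶠ q in 𝓝[K] p, ε ≤ dist (L q) (L p) := by
    rw [ContinuousWithinAt, Metric.tendsto_nhds] at hcont
    push Not at hcont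
    exact hcont
  -- Interlock points of `A` with functions of `K` that stay `ε`-bad. The natural number in each
  -- triple exceeds all earlier ones, so the tolerances tend to 0.
  obtain ⟨s, hs, hr⟩ := exists_seq_of_forall_finset_exists
    (fun y : X × Cp X × ℕ => y.1 ∈ A ∧ y.2.1 ∈ K ∧ ε ≤ dist (L y.2.1) (L p) ∧
      dist (p.1 y.1) (L p) < 1 / ((y.2.2 : ℝ) + 1))
    (fun y z => y.2.2 < z.2.2 ∧ dist (y.2.1.1 z.1) (L y.2.1) < 1 / ((z.2.2 : ℝ) + 1) ∧
      dist (z.2.1.1 y.1) (p.1 y.1) < 1 / ((z.2.2 : ℝ) + 1)) (by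
    intro s _
    obtain ⟨N, hN⟩ : ∃ N, ∀ y ∈ s, y.2.2 < N :=
      ⟨s.sup (fun y => y.2.2) + 1, fun y hy => Nat.lt_succ_of_le (s.le_sup (f := fun y => y.2.2) hy)⟩
    have hδ : (0 : ℝ) < 1 / ((N : ℝ) + 1) := Nat.one_div_pos_of_nat
    have h1 : ∀ᶠ x in F, ∀ y ∈ s, dist (y.2.1.1 x) (L y.2.1) < 1 / ((N : ℝ) + 1) :=
      s.eventually_all.2 fun y _ => Metric.tendsto_nhds.1 (hL y.2.1) _ hδ
    have h2 : ∀ᶠ x in F, dist (p.1 x) (L p) < 1 / ((N : ℝ) + 1) :=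
      Metric.tendsto_nhds.1 (hL p) _ hδ
    obtain ⟨x, hx1, hx2, hxA⟩ := (h1.and (h2.and hAF)).exists
    have h3 : ∀ᶠ q in 𝓝[K] p, ∀ y ∈ s, dist (q.1 y.1) (p.1 y.1) < 1 / ((N : ℝ) + 1) :=
      s.eventually_all.2 fun y _ => Metric.tendsto_nhds.1
        (((Cp.continuous_eval y.1).tendsto p).mono_left nhdsWithin_le_nhds) _ hδ
    obtain ⟨q, hq1, hq2, hqK⟩ := (hfreq.and_eventually (h3.and self_mem_nhdsWithin)).exists
    exact ⟨(x, q, N), ⟨hxA, hqK, hq1, hx2⟩, fun y hy => ⟨hN y hy, hx1 y hy, hq2 y hy⟩⟩)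
  let x n := (s n).1
  let q n := (s n).2.1
  have hmono : StrictMono fun n => (s n).2.2 := strictMono_nat_of_lt_succ fun n =>
    (hr n (n + 1) n.lt_succ_self).1
  have hlim : Tendsto (fun n => 1 / (((s n).2.2 : ℝ) + 1)) atTop (𝓝 0) :=
    (tendsto_one_div_add_atTop_nhds_zero_nat (𝕜 := ℝ)).comp hmono.tendsto_atTop
  have hpx : Tendsto (fun n => p.1 (x n)) atTop (𝓝 (L p)) :=
    tendsto_iff_dist_tendsto_zero.2 (squeeze_zero (fun _ => dist_nonneg)
      (fun n => (hs n).2.2.2.le) hlim)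
  have hqx (i : ℕ) : Tendsto (fun n => (q i).1 (x n)) atTop (𝓝 (L (q i))) :=
    tendsto_iff_dist_tendsto_zero.2 (squeeze_zero' (.of_forall fun _ => dist_nonneg)
      ((eventually_gt_atTop i).mono fun n hn => (hr i n hn).2.1.le) hlim)
  have hxq (i : ℕ) : Tendsto (fun n => (q n).1 (x i)) atTop (𝓝 (p.1 (x i))) :=
    tendsto_iff_dist_tendsto_zero.2 (squeeze_zero' (.of_forall fun _ => dist_nonneg)
      ((eventually_gt_atTop i).mono fun n hn => (hr i n hn).2.2.le) hlim)
  have hle : (hyperfilter ℕ : Filter ℕ) ≤ atTop := Nat.hyperfilter_le_atTop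
  let G := (hyperfilter ℕ).map x
  -- `L'` agrees with `L` on `p` and every `q i`, but also controls the cluster point `r`, which
  -- equals `p` on all `x i`. A single `x₀` then gives `L (q n) = q n x₀ → r x₀ = L' r = L p`.
  obtain ⟨L', hL'⟩ := lim G (mem_map.2 <| Filter.univ_mem' fun n => (hs n).1)
  have hL'p : L' p = L p := tendsto_nhds_unique (hL' p) (tendsto_map'_iff.2 (hpx.mono_left hle))
  have hL'q (i : ℕ) : L' (q i) = L (q i) :=
    tendsto_nhds_unique (hL' (q i)) (tendsto_map'_iff.2 ((hqx i).mono_left hle))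
  obtain ⟨x₀, hx₀⟩ := hL'.exists_eval_eq q
  obtain ⟨r, -, hr⟩ := isCompact_iff_ultrafilter_le_nhds.1 hK ((hyperfilter ℕ).map q)
    (le_principal_iff.2 (mem_map.2 <| Filter.univ_mem' fun n => (hs n).2.1))
  have hqr : Tendsto q (hyperfilter ℕ) (𝓝 r) := hr
  have hrx (i : ℕ) : r.1 (x i) = p.1 (x i) :=
    tendsto_nhds_unique (Cp.tendsto_iff.1 hqr (x i)) ((hxq i).mono_left hle)
  have hL'r : L' r = L p := by
    refine tendsto_nhds_unique (tendsto_map'_iff.1 (hL' r)) ((hpx.mono_left hle).congr fun n => ?_)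
    exact (hrx n).symm
  have hrx₀ : r.1 x₀ = L' r := hL'.eval_eq_of_mem_closure hx₀
    (mem_closure_of_tendsto hqr (.of_forall Set.mem_range_self))
  have hlast : Tendsto (fun n => L (q n)) (hyperfilter ℕ) (𝓝 (L p)) := by
    rw [← hL'r, ← hrx₀]
    refine (Cp.tendsto_iff.1 hqr x₀).congr fun n => ?_
    rw [hx₀, hL'q]
  obtain ⟨n, hn⟩ := (Metric.tendsto_nhds.1 hlast ε hε).exists
  exact ((hs n).2.2.1.trans_lt hn).false

theorem IsKappaSpace.isMuSpace {X : Type u} [TopologicalSpace X] (hX : IsKappaSpace X) :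
    IsMuSpace X := by
  refine ⟨hX.t35, fun A hA => isCompact_iff_ultrafilter_le_nhds.2 fun F hF => ?_⟩
  have hb : IsFunctionallyBounded (closure A) := fun f hf =>
    (hA f hf).closure.subset (image_closure_subset_closure_image hf)
  obtain ⟨x, hx⟩ := hX.exists_le_nhds (hb.isKappaCauchy (le_principal_iff.1 hF))
  exact ⟨x, isClosed_closure.mem_of_tendsto (f := id) hx (le_principal_iff.1 hF), hx⟩

/-! ### Pseudometrics and uniformities -/

theorem Cp.isCompact_lipschitz (P : Type u) [PseudoMetricSpace P] (ε : ℝ) :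
    IsCompact {f : Cp P | (∀ x y, dist (f.1 x) (f.1 y) ≤ dist x y) ∧ ∀ x, f.1 x ∈ Set.Icc 0 ε} := by
  have hc : IsClosed {f : P → ℝ | ∀ x y, dist (f x) (f y) ≤ dist x y} := by
    simp only [Set.ofPred_forall]
    exact isClosed_iInter fun x => isClosed_iInter fun y =>
      isClosed_le ((continuous_apply x).dist (continuous_apply y)) continuous_const
  have hk : IsCompact (Set.univ.pi fun _ : P => Set.Icc (0 : ℝ) ε) :=
    isCompact_univ_pi fun _ => isCompact_Icc
  refine Topology.IsInducing.subtypeVal.isCompact_iff.2 ?_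
  convert hk.inter_left hc using 1
  ext f
  constructor
  · rintro ⟨g, hg, rfl⟩
    exact ⟨hg.1, fun x _ => hg.2 x⟩
  · rintro ⟨h1, h2⟩
    have : LipschitzWith 1 f := LipschitzWith.of_dist_le_mul fun x y => by simpa using h1 x y
    exact ⟨⟨f, this.continuous⟩, ⟨h1, fun x => h2 x trivial⟩, rfl⟩

/-- The truncations of `ε - infDist x s` at 0 lie in a compact set of 1-Lipschitz functions and tend
to the constant `ε`. If no `ε`-ball were in `F`, `L` would vanish on them for nonempty `s`,
contradicting continuity on that compact set. -/
theorem Ultrafilter.IsKappaCauchy.exists_ball_mem {P : Type u} [PseudoMetricSpace P]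
    {F : Ultrafilter P} (hF : F.IsKappaCauchy) {ε : ℝ} (hε : 0 < ε) :
    ∃ x, Metric.ball x ε ∈ F := by
  by_contra! hball
  obtain ⟨L, hL, hK⟩ := hF
  let c : Cp P := ⟨fun _ => ε, continuous_const⟩
  let p (s : Finset P) : Cp P := ⟨fun x => max 0 (ε - Metric.infDist x s),
    continuous_const.max (continuous_const.sub (Metric.continuous_infDist_pt _))⟩
  have hp : Tendsto p atTop (𝓝 c) := by
    refine Cp.tendsto_iff.2 fun x => tendsto_const_nhds.congr' ?_
    filter_upwards [eventually_ge_atTop {x}] with s hs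
    have := Metric.infDist_zero_of_mem (Finset.mem_coe.2 (Finset.singleton_subset_iff.1 hs))
    simp [p, c, this, hε.le]
  have hpK : ∀ s, (∀ x y, dist ((p s).1 x) ((p s).1 y) ≤ dist x y) ∧
      ∀ x, (p s).1 x ∈ Set.Icc 0 ε := fun s => by
    refine ⟨fun x y => ?_, fun x => ⟨le_max_left _ _, ?_⟩⟩
    · have h1 := (Metric.lipschitz_infDist_pt (s : Set P)).dist_le_mul x y
      rw [Real.dist_eq, NNReal.coe_one, one_mul] at h1
      have h2 := abs_max_sub_max_le_abs (ε - Metric.infDist x s) (ε - Metric.infDist y s) 0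
      rw [sub_sub_sub_cancel_left, abs_sub_comm (Metric.infDist y _)] at h2
      simp only [p, Real.dist_eq, max_comm (0 : ℝ)]
      exact h2.trans h1
    · exact max_le hε.le (sub_le_self _ Metric.infDist_nonneg)
  have hLp : ∀ᶠ s in atTop, L (p s) = 0 := by
    -- `infDist` to the empty set is 0, so `s = ∅` must be excluded.
    obtain ⟨x₀⟩ : Nonempty P := F.nonempty_of_mem univ_mem |>.to_type
    filter_upwards [eventually_ge_atTop {x₀}] with s hs
    have hne : (s : Set P).Nonempty := ⟨x₀, Finset.singleton_subset_iff.1 hs⟩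
    refine tendsto_nhds_unique (hL (p s)) (tendsto_const_nhds.congr' ?_)
    have : ∀ᶠ y in F, ∀ x ∈ s, y ∉ Metric.ball x ε :=
      s.eventually_all.2 fun x _ => Ultrafilter.compl_mem_iff_notMem.2 (hball x)
    filter_upwards [this] with y hy
    refine (max_eq_left (sub_nonpos.2 ((Metric.le_infDist hne).2 fun x hx => ?_))).symm
    simpa using hy x hx
  have hLc : L c = ε := tendsto_nhds_unique (hL c) tendsto_const_nhds
  have h1 := (hK _ (Cp.isCompact_lipschitz P ε) c ⟨fun x y => by simp [c], fun x => ⟨hε.le, le_rfl⟩⟩)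
  have h2 : Tendsto (fun s => L (p s)) atTop (𝓝 (L c)) :=
    h1.tendsto.comp (tendsto_nhdsWithin_iff.2 ⟨hp, .of_forall hpK⟩)
  rw [hLc] at h2
  exact hε.ne (tendsto_nhds_unique (tendsto_const_nhds.congr' (hLp.mono fun _ h => h.symm)) h2)

theorem Ultrafilter.IsKappaCauchy.cauchy {P : Type u} [PseudoMetricSpace P]
    {F : Ultrafilter P} (hF : F.IsKappaCauchy) : Cauchy (F : Filter P) := by
  refine Metric.cauchy_iff.2 ⟨F.neBot, fun ε hε => ?_⟩
  obtain ⟨x, hx⟩ := hF.exists_ball_mem (half_pos hε)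
  exact ⟨_, hx, fun y hy z hz => by
    linarith [dist_triangle_right y z x, Metric.mem_ball.1 hy, Metric.mem_ball.1 hz]⟩

/-- Each entourage is refined by a uniformly continuous map to a pseudometric space. -/
theorem exists_pseudoMetricSpace_dist_lt_subset {X : Type u} [U : UniformSpace X] {V : Set (X × X)}
    (hV : V ∈ uniformity X) : ∃ (P : Type u) (_ : PseudoMetricSpace P) (φ : X → P), Continuous φ ∧
      ∃ ε > 0, ∀ x y, dist (φ x) (φ y) < ε → (x, y) ∈ V := by
  choose! t ht htsymm htcomp using fun (s : Set (X × X)) (hs : s ∈ uniformity X) =>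
    comp_symm_mem_uniformity_sets hs
  let W (n : ℕ) : Set (X × X) := t^[n] V
  have hWs (n : ℕ) : W (n + 1) = t (W n) := Function.iterate_succ_apply' t n V
  have hW (n : ℕ) : W n ∈ uniformity X := by
    induction n with
    | zero => exact hV
    | succ n ih => exact hWs n ▸ ht _ ih
  have hanti : Antitone W := antitone_nat_of_succ_le fun n => by
    rintro ⟨x, y⟩ hxy
    rw [hWs] at hxy
    exact htcomp _ (hW n) ⟨y, hxy, refl_mem_uniformity (ht _ (hW n))⟩
  have hb := hasBasis_iInf_principal hanti.directed_ge
  let C : UniformSpace.Core X :=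
    { uniformity := ⨅ n, 𝓟 (W n)
      refl := le_iInf fun n => refl_le_uniformity.trans (le_principal_iff.2 (hW n))
      symm := (hb.tendsto_iff hb).2 fun n _ => ⟨n + 1, trivial, fun z hz => by
        rw [hWs] at hz
        have := htsymm _ (hW n)
        exact hanti n.le_succ (hWs n ▸ this.symm _ _ hz)⟩
      comp := ((hb.lift' (monotone_id.relComp monotone_id)).le_basis_iff hb).2 fun n _ =>
        ⟨n + 1, trivial, by
          change SetRel.comp (W (n + 1)) (W (n + 1)) ⊆ W n
          rw [hWs]
          exact htcomp _ (hW n)⟩ }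
  have hU : U ≤ UniformSpace.ofCore C := le_iInf fun n => le_principal_iff.2 (hW n)
  have : IsCountablyGenerated (𝓤[UniformSpace.ofCore C]) := by
    exact ⟨_, Set.countable_range fun n => W n, by
      rw [generate_eq_biInf, iInf_range]; rfl⟩
  obtain ⟨I, hI⟩ := @UniformSpace.metrizable_uniformity X (.ofCore C) this
  -- `P` is `X` itself with a pseudometric for the coarser, countably generated uniformity of the
  -- iterates `W n`.
  refine ⟨X, I, id, ?_, ?_⟩
  · rw [← hI] at hU
    exact continuous_id_iff_le.2 (UniformSpace.toTopologicalSpace_mono hU)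
  · have hV : V ∈ 𝓤[I.toUniformSpace] := by
      rw [hI]
      exact hb.mem_of_mem (i := 0) trivial
    obtain ⟨ε, hε, h⟩ := Metric.mem_uniformity_dist.1 hV
    exact ⟨ε, hε, fun x y hxy => h hxy⟩

/-! ### Permanence properties and classes of `κ`-spaces -/

theorem IsKappaSpace.pi {ι : Type v} {X : ι → Type u} [∀ i, TopologicalSpace (X i)]
    (h : ∀ i, IsKappaSpace (X i)) : IsKappaSpace (∀ i, X i) := by
  have := fun i => (h i).t35
  refine .of_forall_ultrafilter fun F hF => ?_
  choose x hx using fun i => (h i).exists_le_nhds (hF.map (continuous_apply i))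
  exact ⟨x, tendsto_pi_nhds (f := id).2 hx⟩

theorem IsKappaSpace.of_isProperMap {X : Type u} {Y : Type v} [TopologicalSpace X]
    [TopologicalSpace Y] [T35Space X] {f : X → Y} (hf : IsProperMap f) (hY : IsKappaSpace Y) :
    IsKappaSpace X := by
  refine .of_forall_ultrafilter fun F hF => ?_
  obtain ⟨y, hy⟩ := hY.exists_le_nhds (hF.map hf.continuous)
  obtain ⟨x, -, hx⟩ := hf.ultrafilter_le_nhds_of_tendsto hy
  exact ⟨x, hx⟩

theorem IsKappaSpace.of_isClosed {X : Type u} [TopologicalSpace X] (hX : IsKappaSpace X)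
    {S : Set X} (hS : IsClosed S) : IsKappaSpace S :=
  have := hX.t35
  .of_isProperMap hS.isClosedEmbedding_subtypeVal.isProperMap hX

theorem IsKappaSpace.sInter {X : Type u} [TopologicalSpace X] [T35Space X] {M : Set (Set X)}
    (hM : M.Nonempty) (h : ∀ S ∈ M, IsKappaSpace S) : IsKappaSpace (⋂₀ M : Set X) := by
  refine .of_forall_ultrafilter fun F hF => ?_
  have key (S : Set X) (hS : S ∈ M) : ∃ x ∈ S, Tendsto Subtype.val (F : Filter ↥(⋂₀ M)) (𝓝 x) := by
    obtain ⟨x, hx⟩ := (h S hS).exists_le_nhds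
      (hF.map (continuous_inclusion (Set.sInter_subset_of_mem hS)))
    exact ⟨x, x.2, (continuous_subtype_val.tendsto x).comp hx⟩
  obtain ⟨S, hS⟩ := hM
  obtain ⟨x, -, hx⟩ := key S hS
  refine ⟨⟨x, fun T hT => ?_⟩, tendsto_subtype_rng (f := id).2 hx⟩
  obtain ⟨y, hyT, hy⟩ := key T hT
  exact tendsto_nhds_unique hy hx ▸ hyT

/-- Adjoin `L` to the copy of `X` in the power of `ℝ` indexed by `Cp X`. Coordinates extend all
continuous functions, so `L` must already be an evaluation. -/
theorem IsRealcompactSpace.isKappaSpace {X : Type u} [TopologicalSpace X]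
    (hX : IsRealcompactSpace X) : IsKappaSpace X := by
  have := hX.t35
  refine .of_forall_ultrafilter fun F ⟨L, hL, _⟩ => ?_
  let φ (x : X) (f : Cp X) : ℝ := f.1 x
  have hφ : Continuous φ := continuous_pi fun f => f.2
  have hFL : Tendsto φ F (𝓝 L) := tendsto_pi_nhds.2 hL
  have hind : IsInducing φ := isInducing_iff_nhds.2 fun x => le_antisymm
    (hφ.tendsto x).le_comap (T35Space.le_nhds_of_forall_tendsto fun f =>
      ((continuous_apply f).tendsto (φ x)).comp tendsto_comap)
  let Z : Set (Cp X → ℝ) := insert L (Set.range φ)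
  let e (x : X) : Z := ⟨φ x, .inr ⟨x, rfl⟩⟩
  have he : IsInducing e := IsInducing.of_comp (hφ.subtype_mk _) continuous_subtype_val hind
  have hdense : DenseRange e := by
    rintro ⟨z, rfl | ⟨x, rfl⟩⟩
    · exact mem_closure_of_tendsto (tendsto_subtype_rng.2 hFL)
        (Eventually.of_forall Set.mem_range_self)
    · exact subset_closure ⟨x, rfl⟩
  obtain ⟨x, hx⟩ := hX.surjective_of_extends Z e he.isEmbedding hdense
    (fun f hf => ⟨fun z => z.1 ⟨f, hf⟩, (continuous_apply _).comp continuous_subtype_val,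
      fun _ => rfl⟩) ⟨L, .inl rfl⟩
  refine ⟨x, T35Space.le_nhds_of_forall_tendsto fun f => ?_⟩
  have : φ x = L := congrArg Subtype.val hx
  rw [show f.1 x = L f from congrFun this f]
  exact hL f

theorem IsKappaSpace.of_isKRSpace_cp {X : Type u} [TopologicalSpace X] [T35Space X]
    (h : IsKRSpace (Cp X)) : IsKappaSpace X :=
  .of_forall_ultrafilter fun _ ⟨L, hL, hK⟩ =>
    hL.exists_le_nhds_of_continuous (h.continuous_of_continuousOn L hK)

theorem IsKRSpace.isKappaSpace_cp {X : Type u} [TopologicalSpace X] (h : IsKRSpace X) :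
    IsKappaSpace (Cp X) :=
  .of_forall_ultrafilter fun _ hF =>
    hF.exists_le_nhds_of_isClosedEmbedding h.continuous_of_continuousOn .id

theorem IsKappaSpace.of_metrizableSpace {X : Type u} [TopologicalSpace X]
    [TopologicalSpace.MetrizableSpace X] : IsKappaSpace X := by
  let _ := TopologicalSpace.metrizableSpaceMetric X
  refine .of_forall_ultrafilter fun F hF => ?_
  obtain ⟨m, hm⟩ := cauchy_map_iff_exists_tendsto.1
    (hF.cauchy.map (UniformSpace.Completion.uniformContinuous_coe X))
  obtain ⟨L, hL, -⟩ := hF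
  obtain ⟨x, rfl⟩ := hL.mem_range_of_tendsto (UniformSpace.Completion.continuous_coe X) hm
  refine ⟨x, ?_⟩
  rw [(UniformSpace.Completion.isUniformInducing_coe X).isInducing.nhds_eq_comap]
  exact tendsto_iff_comap.1 hm

theorem IsDieudonneComplete.isKappaSpace {X : Type u} [TopologicalSpace X]
    (hX : IsDieudonneComplete X) : IsKappaSpace X := by
  have := hX.t35
  obtain ⟨U, rfl, hU⟩ := hX.exists_complete_uniformity
  refine .of_forall_ultrafilter fun F hF => CompleteSpace.complete ⟨F.neBot, fun V hV => ?_⟩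
  obtain ⟨P, _, φ, hφ, ε, hε, hV⟩ := exists_pseudoMetricSpace_dist_lt_subset hV
  obtain ⟨s, hs, hsε⟩ := (Metric.cauchy_iff.1 (hF.map hφ).cauchy).2 ε hε
  exact mem_of_superset (prod_mem_prod hs hs) fun z hz => hV _ _ (hsε _ hz.1 _ hz.2)

theorem IsPseudocompactSpace.isKappaSpace_iff {X : Type u} [TopologicalSpace X]
    (hX : IsPseudocompactSpace X) : IsKappaSpace X ↔ CompactSpace X := by
  have := hX.t35
  refine ⟨fun h => ?_, fun h => .of_forall_ultrafilter fun F _ => ?_⟩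
  · have := h.isMuSpace.isCompact_closure Set.univ fun f hf => by
      simpa using hX.isBounded_range f hf
    exact isCompact_univ_iff.1 (by simpa using this)
  · exact ⟨F.lim, F.le_nhds_lim⟩

/-! ### The space of countable ordinals -/

namespace Ordinal

theorem exists_forall_le_Iio_omega_one {α : Type*} [Countable α]
    (x : α → Set.Iio (omega.{u} 1)) : ∃ b, ∀ n, x n ≤ b := by
  have h : ⨆ n, (x n).1 < omega.{u} 1 := iSup_lt_omega_one fun n => (x n).2
  exact ⟨⟨_, h⟩, fun n => le_ciSup (f := fun n => (x n).1) 
    ⟨_, Set.forall_mem_range.2 fun n => (x n).2.le⟩ n⟩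

theorem isCountablyGenerated_nhds {a : Ordinal.{u}} (ha : (Set.Iio a).Countable) :
    (𝓝 a).IsCountablyGenerated := by
  -- The successor handles all upper rays at once, leaving only countably many lower ones.
  have h : ⨅ b ∈ Set.Ioi a, 𝓟 (Set.Iio b) = 𝓟 (Set.Iio (Order.succ a)) :=
    le_antisymm (iInf₂_le _ (Order.lt_succ a)) (le_iInf₂ fun b hb => principal_mono.2
      (Set.Iio_subset_Iio (Order.succ_le_of_lt hb)))
  have := ha.to_subtype
  rw [nhds_eq_order, h, iInf_subtype']
  infer_instance

theorem countable_Iio_of_lt_omega_one {a : Ordinal.{u}} (ha : a < omega.{u} 1) :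
    (Set.Iio a).Countable := by
  rw [← Cardinal.le_aleph0_iff_set_countable, Cardinal.mk_Iio_ordinal, Cardinal.lift_le_aleph0,
    ← Cardinal.lt_aleph_one_iff]
  exact Cardinal.lt_omega_iff_card_lt.1 ha

theorem firstCountableTopology_Iio_omega_one : FirstCountableTopology (Set.Iio (omega.{u} 1)) := by
  refine ⟨fun a => ?_⟩
  have := isCountablyGenerated_nhds (countable_Iio_of_lt_omega_one a.2)
  rw [nhds_subtype]
  infer_instance

theorem isPseudocompactSpace_Iio_omega_one : IsPseudocompactSpace (Set.Iio (omega.{u} 1)) := by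
  refine ⟨inferInstance, fun f hf => ?_⟩
  by_contra hb
  have hn (n : ℕ) : ∃ x, n < |f x| := by
    by_contra! h
    exact hb (isBounded_iff_forall_norm_le.2 ⟨n, Set.forall_mem_range.2 h⟩)
  choose x hx using hn
  -- The witnesses of unboundedness all lie in one compact initial segment.
  obtain ⟨b, hb⟩ := exists_forall_le_Iio_omega_one x
  have hcomp : IsCompact (Set.Iic b) := by
    rw [Topology.IsInducing.subtypeVal.isCompact_iff]
    have : Subtype.val '' Set.Iic b = Set.Icc 0 b.1 := by
      ext y
      constructor
      · rintro ⟨z, hz, rfl⟩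
        exact ⟨zero_le, hz⟩
      · exact fun hy => ⟨⟨y, hy.2.trans_lt b.2⟩, hy.2, rfl⟩
    rw [this]
    exact isCompact_Icc
  obtain ⟨C, hC⟩ := (hcomp.image hf).isBounded.exists_norm_le
  obtain ⟨n, hn⟩ := exists_nat_gt C
  exact ((hx n).trans_le (hC _ ⟨x n, hb n, rfl⟩)).not_gt hn

theorem not_compactSpace_Iio_omega_one : ¬ CompactSpace (Set.Iio (omega.{u} 1)) := by
  intro h
  obtain ⟨a, -, ha⟩ := (isCompact_univ (X := Set.Iio (omega.{u} 1))).exists_isGreatest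
    ⟨⟨0, omega_pos 1⟩, trivial⟩
  have hs := (Cardinal.isSuccLimit_omega 1).succ_lt a.2
  exact (Order.lt_succ a.1).not_ge (ha (Set.mem_univ ⟨_, hs⟩))

end Ordinal

end KappaSpaces

theorem propositionp :
    -- (i) arbitrary products
    (∀ (ι : Type v) (X : ι → Type u) [∀ i, TopologicalSpace (X i)],
      (∀ i, IsKappaSpace (X i)) → IsKappaSpace (∀ i, X i)) ∧
    -- (ii) closed subspaces
    (∀ (X : Type u) [TopologicalSpace X] (S : Set X),
      IsKappaSpace X → IsClosed S → IsKappaSpace S) ∧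
    -- (iii) realcompact spaces
    (∀ (X : Type u) [TopologicalSpace X], IsRealcompactSpace X → IsKappaSpace X) ∧
    -- (iv) intersections of (nonempty families of) subspaces
    (∀ (X : Type u) [TopologicalSpace X] [T35Space X] (M : Set (Set X)), M.Nonempty →
      (∀ S ∈ M, IsKappaSpace S) → IsKappaSpace (⋂₀ M : Set X)) ∧
    -- (v) preimages under perfect mappings
    (∀ (X : Type u) (Y : Type v) [TopologicalSpace X] [TopologicalSpace Y] [T35Space X]
      (f : X → Y), IsProperMap f → IsKappaSpace Y → IsKappaSpace X) ∧
    -- (vi) spaces `X` such that `C_p(X)` is a `k_ℝ`-space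
    (∀ (X : Type u) [TopologicalSpace X] [T35Space X], IsKRSpace (Cp X) → IsKappaSpace X) ∧
    -- (vii) `κ`-spaces are `μ`-spaces
    (∀ (X : Type u) [TopologicalSpace X], IsKappaSpace X → IsMuSpace X) ∧
    -- (viii) metrizable spaces
    (∀ (X : Type u) [TopologicalSpace X] [TopologicalSpace.MetrizableSpace X],
      IsKappaSpace X) ∧
    -- (ix) Dieudonné complete spaces
    (∀ (X : Type u) [TopologicalSpace X], IsDieudonneComplete X → IsKappaSpace X) ∧
    -- (x) pseudocompact spaces, and the space `ω₁` of countable ordinals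
    ((∀ (X : Type u) [TopologicalSpace X], IsPseudocompactSpace X →
      (IsKappaSpace X ↔ CompactSpace X)) ∧
      FirstCountableTopology (Set.Iio (Ordinal.omega.{0} 1)) ∧
      IsPseudocompactSpace (Set.Iio (Ordinal.omega.{0} 1)) ∧
      ¬ IsKappaSpace (Set.Iio (Ordinal.omega.{0} 1))) ∧
    -- (xi) function spaces over `k_ℝ`-spaces
    (∀ (X : Type u) [TopologicalSpace X], IsKRSpace X → IsKappaSpace (Cp X)) := by
  exact ⟨fun _ _ _ => IsKappaSpace.pi, fun _ _ _ hX hS => hX.of_isClosed hS,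
    fun _ _ => IsRealcompactSpace.isKappaSpace, fun _ _ _ _ => IsKappaSpace.sInter,
    fun _ _ _ _ _ _ => IsKappaSpace.of_isProperMap, fun _ _ _ => IsKappaSpace.of_isKRSpace_cp,
    fun _ _ => IsKappaSpace.isMuSpace, fun _ _ _ => IsKappaSpace.of_metrizableSpace,
    fun _ _ => IsDieudonneComplete.isKappaSpace,
    ⟨fun _ _ => IsPseudocompactSpace.isKappaSpace_iff,
      Ordinal.firstCountableTopology_Iio_omega_one, Ordinal.isPseudocompactSpace_Iio_omega_one,
      fun h => Ordinal.not_compactSpace_Iio_omega_one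
        (Ordinal.isPseudocompactSpace_Iio_omega_one.isKappaSpace_iff.1 h)⟩,
    fun _ _ => IsKRSpace.isKappaSpace_cp⟩
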